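/- All Hilbert spaces are finite-dimensional, all sets are finite, and a state on a Hilbert space $\mathcal{H}$ is a density matrix: an operator $\rho\ge 0$ on $\mathcal{H}$ with $\operatorname{Tr}\rho=1$. Let $Q$ and $Q'$ be quantum systems with Hilbert spaces $\mathcal{H}_Q$ and $\mathcal{H}_{Q'}$, let $\omega_Q$ and $\omega_{Q'}$ be the Gibbs states of the two systems, i.e. fixed states, arbitrary otherwise (if $Q=Q'$, one may take $\omega_Q=\omega_{Q'}=\omega$), and let $\rho$ be a state on $\mathcal{H}_Q$ and $\sigma$ a state on $\mathcal{H}_{Q'}$. Then the following are equivalent. (i) There is a Gibbs-state-preserving transition from $\rho$ to $\sigma$: a completely positive trace-preserving linear map $\Phi:\mathrm{L}(\mathcal{H}_Q)\to\mathrm{L}(\mathcal{H}_{Q'})$ with $\Phi(\omega_Q)=\omega_{Q'}$ and $\Phi(\rho)=\sigma$. (ii) $\rho\succeq^*_\omega\sigma$, that is, $(\rho,\omega_Q)\succeq^*(\sigma,\omega_{Q'})$. Here, for pairs of states $(\rho_0,\rho_1)$ on $\mathcal{H}_Q$ and $(\sigma_0,\sigma_1)$ on $\mathcal{H}_{Q'}$,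 the relation $(\rho_0,\rho_1)\succeq^*(\sigma_0,\sigma_1)$ means that for every finite set $\mathcal{U}$, every finite-dimensional Hilbert space $\mathcal{H}_R$, every finite set $\mathcal{Y}$ with $|\mathcal{Y}|=(\dim\mathcal{H}_R)^2$, every family $\{\tau^y\}_{y\in\mathcal{Y}}$ of states on $\mathcal{H}_R$ with $\operatorname{span}_{\mathbb{C}}\{\tau^y\}=\mathrm{L}(\mathcal{H}_R)$, and every probability distribution $p$ on $\mathcal{U}\times\mathcal{Y}\times\{0,1\}$, $$H_{\min}(U|RQ)_{\tilde\rho}\le H_{\min}(U|RQ')_{\tilde\sigma},$$ where $\tilde\rho_{URQ}=\sum_{u,y,x}p(u,y,x)\,|u\rangle\langle u|_U\otimes\tau^y_R\otimes\rho_x$ and $\tilde\sigma_{URQ'}=\sum_{u,y,x}p(u,y,x)\,|u\rangle\langle u|_U\otimes\tau^y_R\otimes\sigma_x$, and where the conditional min-entropy of a bipartite state $\rho_{AB}$ is $$H_{\min}(A|B)_\rho=\sup\{\lambda\in\mathbb{R}:\ \rho_{AB}\le 2^{-\lambda}\,\mathbb{1}_A\otimes s_B\ \text{for some state } s_B\}.$$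 -/

import Mathlib

open scoped Kronecker ComplexOrder MatrixOrder Matrix.Norms.L2Operator CStarAlgebra

/-- A density matrix (state) on the Hilbert space `ℂⁿ` with orthonormal basis indexed by `n`:
a positive semidefinite matrix of unit trace. -/
structure IsDensityMatrix {n : Type*} [Fintype n] (ρ : Matrix n n ℂ) : Prop where
  posSemidef : ρ.PosSemidef
  trace_eq_one : ρ.trace = 1

/-- A complete cq-channel `y ↦ τ y` on `ℂᴿ`: a family of `(dim ℂᴿ)²` density matrices
whose complex linear span is the whole space of operators. -/
structure IsCompleteCQChannel {R Y : Type*} [Fintype R] [Fintype Y]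
    (τ : Y → Matrix R R ℂ) : Prop where
  isDensityMatrix : ∀ y, IsDensityMatrix (τ y)
  card_eq : Fintype.card Y = Fintype.card R ^ 2
  span_eq_top : Submodule.span ℂ (Set.range τ) = ⊤

/-- The numbers `l` with `ρ ≤ 2⁻ˡ • (1 ⊗ s)` in the Loewner order for some state `s` on `B`. -/
def minEntropySet {A B : Type*} [Fintype A] [DecidableEq A] [Fintype B]
    (ρ : Matrix (A × B) (A × B) ℂ) : Set ℝ :=
  {l : ℝ | ∃ s : Matrix B B ℂ, IsDensityMatrix s ∧
    ρ ≤ ((2 : ℝ) ^ (-l)) • ((1 : Matrix A A ℂ) ⊗ₖ s)}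

/-- The conditional min-entropy `H_min(A|B)_ρ` (to base 2) of a bipartite state `ρ`. -/
noncomputable def condMinEntropy {A B : Type*} [Fintype A] [DecidableEq A] [Fintype B]
    (ρ : Matrix (A × B) (A × B) ℂ) : ℝ :=
  sSup (minEntropySet ρ)

/-- For a state, the supremum defining `condMinEntropy` is over a nonempty set. -/
theorem minEntropySet_nonempty {A B : Type*} [Fintype A] [DecidableEq A] [Fintype B]
    {ρ : Matrix (A × B) (A × B) ℂ} (hρ : IsDensityMatrix ρ) : (minEntropySet ρ).Nonempty := by
  classical
  have hB : Nonempty B := by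
    by_contra h
    rw [not_nonempty_iff] at h
    simpa [Matrix.trace] using hρ.trace_eq_one
  have hc : (0:ℝ) < (Fintype.card B) := by exact_mod_cast Fintype.card_pos
  obtain ⟨l, hl1⟩ : ∃ l : ℝ, ‖ρ‖ * (Fintype.card B) ≤ (2:ℝ) ^ (-l) := by
    refine ⟨-Real.logb 2 (‖ρ‖ * (Fintype.card B) + 1), ?_⟩
    rw [neg_neg, Real.rpow_logb (by norm_num) (by norm_num) (by positivity)]
    linarith
  refine ⟨l, ((Fintype.card B : ℝ)⁻¹) • (1 : Matrix B B ℂ), ⟨?_, ?_⟩, ?_⟩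
  · exact Matrix.PosSemidef.one.smul (by positivity)
  · rw [Matrix.trace_smul, Matrix.trace_one, Complex.real_smul]
    push_cast
    exact inv_mul_cancel₀ (by exact_mod_cast hc.ne')
  · rw [Matrix.kronecker_smul, Matrix.one_kronecker_one, smul_smul]
    have h1 : ρ ≤ algebraMap ℝ _ ‖ρ‖ := IsSelfAdjoint.le_algebraMap_norm_self hρ.posSemidef.1
    rw [Algebra.algebraMap_eq_smul_one] at h1
    refine h1.trans ?_
    rw [Matrix.le_iff, ← sub_smul]
    refine Matrix.PosSemidef.one.smul (sub_nonneg.2 ?_)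
    rw [← div_eq_mul_inv, le_div_iff₀ hc]
    exact hl1

/-- For a state, the supremum defining `condMinEntropy` is over a set bounded above. -/
theorem minEntropySet_bddAbove {A B : Type*} [Fintype A] [DecidableEq A] [Fintype B]
    {ρ : Matrix (A × B) (A × B) ℂ} (hρ : IsDensityMatrix ρ) : BddAbove (minEntropySet ρ) := by
  refine ⟨Real.logb 2 (Fintype.card A), ?_⟩
  rintro l ⟨s, hs, h⟩
  have h2 := (Matrix.le_iff.1 h).trace_nonneg
  rw [Matrix.trace_sub, Matrix.trace_smul, Matrix.trace_kronecker, hs.trace_eq_one,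
    hρ.trace_eq_one, Matrix.trace_one, mul_one, sub_nonneg, Complex.real_smul] at h2
  have h3 : (1:ℝ) ≤ 2 ^ (-l) * Fintype.card A := by exact_mod_cast h2
  have hA : (0:ℝ) < Fintype.card A := by
    by_contra h
    have : (Fintype.card A : ℝ) = 0 := le_antisymm (not_lt.1 h) (by positivity)
    rw [this] at h3; norm_num at h3
  rw [Real.le_logb_iff_rpow_le (by norm_num) hA]
  rw [Real.rpow_neg (by norm_num)] at h3
  have := Real.rpow_pos_of_pos (show (0:ℝ) < 2 by norm_num) l
  field_simp at h3
  exact h3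

/-- The tripartite state
`∑ u y x, p (u, y, x) |u⟩⟨u| ⊗ τ y ⊗ ρ x` on `U`, `R` and `Q`,
grouped as the bipartition `U` versus `R ⊗ Q`. -/
noncomputable def cqState {U Y R Q : Type*} [Fintype U] [DecidableEq U] [Fintype Y]
    (p : U × Y × Fin 2 → ℝ) (τ : Y → Matrix R R ℂ) (ρ : Fin 2 → Matrix Q Q ℂ) :
    Matrix (U × (R × Q)) (U × (R × Q)) ℂ :=
  ∑ u, ∑ y, ∑ x, p (u, y, x) • (Matrix.single u u (1 : ℂ) ⊗ₖ (τ y ⊗ₖ ρ x))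

/-- `(ρ 0, ρ 1) ⪰* (σ 0, σ 1)`: the first pair of states is completely more informative than the
second. The auxiliary objects are an arbitrary finite set `U`, an arbitrary finite-dimensional
Hilbert space `ℂᴿ`, an arbitrary complete cq-channel `τ` on it (with finite input alphabet `Y`),
and an arbitrary joint probability distribution `p` on `U × Y × {0, 1}`. -/
def CompletelyMoreInformative {Q Q' : Type*} [Fintype Q] [Fintype Q']
    (ρ : Fin 2 → Matrix Q Q ℂ) (σ : Fin 2 → Matrix Q' Q' ℂ) : Prop :=
  ∀ (U R Y : Type) [Fintype U] [DecidableEq U] [Fintype R] [Fintype Y]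
    (τ : Y → Matrix R R ℂ), IsCompleteCQChannel τ →
    ∀ p ∈ stdSimplex ℝ (U × Y × Fin 2),
      condMinEntropy (cqState p τ ρ) ≤ condMinEntropy (cqState p τ σ)

/-- `ρ ⪰*_ω σ`, where `ω` is the Gibbs state of the system of `ρ`, and `ω'` the Gibbs state of
the system of `σ` (the same `ω` if the two systems coincide): `(ρ, ω) ⪰* (σ, ω')`. -/
def CompletelyLessThermal {Q Q' : Type*} [Fintype Q] [Fintype Q']
    (ω : Matrix Q Q ℂ) (ω' : Matrix Q' Q' ℂ) (ρ : Matrix Q Q ℂ) (σ : Matrix Q' Q' ℂ) : Prop :=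
  CompletelyMoreInformative ![ρ, ω] ![σ, ω']

/-- An `ω`-preserving transition from `ρ` to `σ` exists: there is a completely positive
trace-preserving linear map taking the Gibbs state to the Gibbs state and `ρ` to `σ`. -/
def ExistsGibbsPreservingTransition {Q Q' : Type*} [Fintype Q] [DecidableEq Q] [Fintype Q']
    [DecidableEq Q'] (ω : Matrix Q Q ℂ) (ω' : Matrix Q' Q' ℂ)
    (ρ : Matrix Q Q ℂ) (σ : Matrix Q' Q' ℂ) : Prop :=
  ∃ Φ : Matrix Q Q ℂ →CP Matrix Q' Q' ℂ,
    (∀ A, (Φ A).trace = A.trace) ∧ Φ ω = ω' ∧ Φ ρ = σ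

/-!
A channel applied to `Q` turns an operator `s` that certifies a bound on `H_min(U|RQ)` into one
that certifies the same bound on `H_min(U|RQ')` (`condMinEntropy_cqState_le`). This gives one
direction.

For the other one, suppose no channel takes `ρ 0, ρ 1` to `σ 0, σ 1`. In terms of Choi matrices,
the point `(σ 0, σ 1, 1)` is not in the image of the compact convex set of positive semidefinite
matrices of trace `dim Q` under a linear map, so Hahn-Banach separation gives Hermitian `T x` and
`S` with `∑ x, T x ⊗ ρ x ≤ 1 ⊗ S` and `Tr S < ∑ x, Tr (T x * (σ x)ᵀ)`
(`exists_separating_observables`). These are turned into a cq-state that violates the assumed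
order. Take for `R` a copy of `Q'` with basis a cyclic group, for `U` the index set of the Weyl
operators `W u : Q' → R`, and `O u x = W u * T x * (W u)ᴴ`. Since the `τ y` span, the `O u x` are,
up to a positive factor and a common shift, the operators `∑ y, p (u, y, x) • τ y` for some
probability distribution `p` (`IsCompleteCQChannel.exists_distribution`).

* All blocks `∑ x, O u x ⊗ ρ x` lie below `1 ⊗ S`, whence a lower bound on the min-entropy for `ρ`
  (`neg_logb_trace_le_condMinEntropy`).
* The entries of the `W u` form an orthogonal basis of maximally entangled vectors of `R ⊗ Q'`.
  Measuring in it undoes the conjugation by `W u`, so that the block with index `u` contributes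
  `∑ x, Tr (T x * (σ x)ᵀ)`, whence an upper bound on the min-entropy for `σ`
  (`sum_weylOperator_le_of_mem_minEntropySet`).

The shift adds the same amount to both values, so the strict inequality between `Tr S` and
`∑ x, Tr (T x * (σ x)ᵀ)` makes the min-entropy for `ρ` strictly larger than the one for `σ`. No
duality theorem for the min-entropy is needed beyond the separation itself.
-/

/-! ### Completely positive maps on matrix algebras -/

/-- Positivity of a matrix of matrices in `CStarMatrix` is positive semidefiniteness of the
flattened matrix. -/
theorem cstarMatrix_nonneg_iff_posSemidef {n Q : Type*} [Fintype n] [Fintype Q] [DecidableEq Q]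
    (M : CStarMatrix n n (Matrix Q Q ℂ)) :
    0 ≤ M ↔ (Matrix.of fun a b : n × Q => M a.1 b.1 a.2 b.2).PosSemidef := by
  classical
  have key : ∀ N : CStarMatrix n n (Matrix Q Q ℂ),
      (Matrix.of fun a b : n × Q => (star N * N) a.1 b.1 a.2 b.2) =
        (Matrix.of fun a b : n × Q => N a.1 b.1 a.2 b.2).conjTranspose *
          (Matrix.of fun a b : n × Q => N a.1 b.1 a.2 b.2) := by
    intro N
    ext a b
    simp only [Matrix.of_apply, CStarMatrix.mul_apply, CStarMatrix.star_apply, Matrix.sum_apply,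
      Matrix.mul_apply, Fintype.sum_prod_type, Matrix.conjTranspose_apply, Matrix.star_apply]
  constructor
  · intro h
    rw [StarOrderedRing.nonneg_iff] at h
    induction h using AddSubmonoid.closure_induction with
    | mem x hx =>
      obtain ⟨N, rfl⟩ := hx
      simp only [key]
      exact Matrix.posSemidef_conjTranspose_mul_self _
    | zero => exact Matrix.PosSemidef.zero
    | add x y _ _ hx hy => exact hx.add hy
  · intro h
    obtain ⟨B, hB⟩ := CStarAlgebra.nonneg_iff_eq_star_mul_self.1
      (Matrix.nonneg_iff_posSemidef.2 h)
    let N : CStarMatrix n n (Matrix Q Q ℂ) := CStarMatrix.ofMatrix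
      (Matrix.of fun i j => Matrix.of fun k l => B (i, k) (j, l))
    have : M = star N * N := by
      ext i j k l
      have h1 := congrFun (congrFun (key N) (i, k)) (j, l)
      have h2 := congrFun (congrFun hB (i, k)) (j, l)
      exact h2.trans h1.symm
    rw [this]
    exact star_mul_self_nonneg N

/-- The ampliation `id ⊗ Φ` of a linear map `Φ` between matrix algebras. -/
noncomputable def ampliation (n : Type*) {Q Q' : Type*} (Φ : Matrix Q Q ℂ →ₗ[ℂ] Matrix Q' Q' ℂ) :
    Matrix (n × Q) (n × Q) ℂ →ₗ[ℂ] Matrix (n × Q') (n × Q') ℂ where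
  toFun X := Matrix.of fun a b => Φ (Matrix.of fun k l => X (a.1, k) (b.1, l)) a.2 b.2
  map_add' X Y := by
    ext a b
    exact congrFun (congrFun (map_add Φ (Matrix.of fun k l => X (a.1, k) (b.1, l))
      (Matrix.of fun k l => Y (a.1, k) (b.1, l))) a.2) b.2
  map_smul' c X := by
    ext a b
    exact congrFun (congrFun (map_smul Φ c (Matrix.of fun k l => X (a.1, k) (b.1, l))) a.2) b.2

theorem ampliation_apply {n Q Q' : Type*} (Φ : Matrix Q Q ℂ →ₗ[ℂ] Matrix Q' Q' ℂ)
    (X : Matrix (n × Q) (n × Q) ℂ) (a b : n × Q') :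
    ampliation n Φ X a b = Φ (Matrix.of fun k l => X (a.1, k) (b.1, l)) a.2 b.2 := rfl

theorem ampliation_kronecker {n Q Q' : Type*} (Φ : Matrix Q Q ℂ →ₗ[ℂ] Matrix Q' Q' ℂ)
    (A : Matrix n n ℂ) (X : Matrix Q Q ℂ) : ampliation n Φ (A ⊗ₖ X) = A ⊗ₖ Φ X := by
  ext a b
  exact congrFun (congrFun (map_smul Φ (A a.1 b.1) X) a.2) b.2

theorem trace_ampliation {n Q Q' : Type*} [Fintype n] [Fintype Q] [Fintype Q']
    {Φ : Matrix Q Q ℂ →ₗ[ℂ] Matrix Q' Q' ℂ} (hΦ : ∀ A, (Φ A).trace = A.trace)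
    (X : Matrix (n × Q) (n × Q) ℂ) : (ampliation n Φ X).trace = X.trace := by
  simp only [Matrix.trace, Matrix.diag, Fintype.sum_prod_type, ampliation_apply] at hΦ ⊢
  exact Finset.sum_congr rfl fun i _ => hΦ _

theorem posSemidef_ampliation {n Q Q' : Type*} [Fintype n] [Fintype Q] [DecidableEq Q]
    [Fintype Q'] [DecidableEq Q'] (Φ : Matrix Q Q ℂ →CP Matrix Q' Q' ℂ)
    {X : Matrix (n × Q) (n × Q) ℂ} (hX : X.PosSemidef) :
    (ampliation n Φ.toLinearMap X).PosSemidef := by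
  let M : CStarMatrix n n (Matrix Q Q ℂ) := CStarMatrix.ofMatrix
    (Matrix.of fun i j => Matrix.of fun k l => X (i, k) (j, l))
  have h := Φ.map_cstarMatrix_nonneg M ((cstarMatrix_nonneg_iff_posSemidef M).2 hX)
  exact (cstarMatrix_nonneg_iff_posSemidef _).1 h

/-! ### Choi matrices -/

/-- The linear map whose Choi matrix `∑ k l, Φ |k⟩⟨l| ⊗ |k⟩⟨l|` is `J`. -/
noncomputable def choiMap {Q Q' : Type*} [Fintype Q] (J : Matrix (Q' × Q) (Q' × Q) ℂ) :
    Matrix Q Q ℂ →ₗ[ℂ] Matrix Q' Q' ℂ where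
  toFun X := Matrix.of fun i j => ∑ k, ∑ l, J (i, k) (j, l) * X k l
  map_add' X Y := by
    ext i j
    simp [mul_add, Finset.sum_add_distrib]
  map_smul' c X := by
    ext i j
    simp [Finset.mul_sum, mul_left_comm]

theorem choiMap_apply {Q Q' : Type*} [Fintype Q] (J : Matrix (Q' × Q) (Q' × Q) ℂ)
    (X : Matrix Q Q ℂ) (i j : Q') :
    choiMap J X i j = ∑ k, ∑ l, J (i, k) (j, l) * X k l := rfl

/-- The partial trace over the first factor. -/
def partialTrace {Q Q' : Type*} [Fintype Q'] (J : Matrix (Q' × Q) (Q' × Q) ℂ) : Matrix Q Q ℂ :=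
  Matrix.of fun k l => ∑ i, J (i, k) (i, l)

theorem one_kronecker_conjugate_apply {n Q Q' : Type*} [Fintype n] [DecidableEq n] [Fintype Q]
    (K : Matrix Q' Q ℂ) (X : Matrix (n × Q) (n × Q) ℂ) (a b : n) (i j : Q') :
    (((1 : Matrix n n ℂ) ⊗ₖ K) * X * ((1 : Matrix n n ℂ) ⊗ₖ K).conjTranspose) (a, i) (b, j) =
      ∑ k, ∑ l, K i k * star (K j l) * X (a, k) (b, l) := by
  simp only [Matrix.mul_apply, Matrix.conjTranspose_apply, Matrix.kroneckerMap_apply,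
    Fintype.sum_prod_type, Matrix.one_apply, ite_mul, one_mul, zero_mul, Finset.sum_ite_irrel,
    Finset.sum_const_zero, Finset.sum_ite_eq, Finset.mem_univ, if_true, apply_ite star, star_zero,
    mul_ite, mul_zero, Finset.sum_mul]
  rw [Finset.sum_comm]
  exact Finset.sum_congr rfl fun k _ => Finset.sum_congr rfl fun l _ => by ring

/-- A positive semidefinite Choi matrix gives a completely positive map: a factorization
`J = Cᴴ * C` is a Kraus decomposition, with one Kraus operator for each row of `C`. -/
theorem posSemidef_ampliation_choiMap {n Q Q' : Type*} [Fintype n] [Fintype Q] [Fintype Q']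
    {J : Matrix (Q' × Q) (Q' × Q) ℂ} (hJ : J.PosSemidef)
    {X : Matrix (n × Q) (n × Q) ℂ} (hX : X.PosSemidef) :
    (ampliation n (choiMap J) X).PosSemidef := by
  classical
  obtain ⟨C, hC⟩ := CStarAlgebra.nonneg_iff_eq_star_mul_self.1 (Matrix.nonneg_iff_posSemidef.2 hJ)
  let K : Q' × Q → Matrix Q' Q ℂ := fun m => Matrix.of fun i k => star (C m (i, k))
  have hJK : ∀ i j k l, J (i, k) (j, l) = ∑ m, K m i k * star (K m j l) := by
    intro i j k l
    simp only [K, Matrix.of_apply, star_star]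
    rw [hC, Matrix.mul_apply]
    rfl
  have : ampliation n (choiMap J) X =
      ∑ m, ((1 : Matrix n n ℂ) ⊗ₖ K m) * X * ((1 : Matrix n n ℂ) ⊗ₖ K m).conjTranspose := by
    ext ⟨a, i⟩ ⟨b, j⟩
    rw [Matrix.sum_apply]
    simp only [one_kronecker_conjugate_apply]
    rw [Finset.sum_comm]
    simp only [ampliation_apply, choiMap_apply, hJK, Matrix.of_apply, Finset.sum_mul]
    exact Finset.sum_congr rfl fun k _ => Finset.sum_comm
  rw [this]
  exact Matrix.posSemidef_sum _ fun m _ => hX.mul_mul_conjTranspose_same _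

theorem trace_choiMap {Q Q' : Type*} [Fintype Q] [DecidableEq Q] [Fintype Q']
    {J : Matrix (Q' × Q) (Q' × Q) ℂ} (hJ : partialTrace J = 1) (A : Matrix Q Q ℂ) :
    (choiMap J A).trace = A.trace := by
  have h : (choiMap J A).trace = ∑ k, ∑ l, partialTrace J k l * A k l := by
    simp only [Matrix.trace, Matrix.diag, choiMap_apply, partialTrace, Matrix.of_apply]
    simp only [Finset.sum_mul]
    rw [Finset.sum_comm]
    refine Finset.sum_congr rfl fun k _ => ?_
    rw [Finset.sum_comm]
  rw [h, hJ]
  simp [Matrix.one_apply, Matrix.trace]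

/-- The completely positive map with a given positive semidefinite Choi matrix. -/
noncomputable def choiCP {Q Q' : Type*} [Fintype Q] [DecidableEq Q] [Fintype Q'] [DecidableEq Q']
    (J : Matrix (Q' × Q) (Q' × Q) ℂ) (hJ : J.PosSemidef) : Matrix Q Q ℂ →CP Matrix Q' Q' ℂ where
  toLinearMap := choiMap J
  map_cstarMatrix_nonneg' k M hM := by
    have h := posSemidef_ampliation_choiMap hJ ((cstarMatrix_nonneg_iff_posSemidef M).1 hM)
    refine (cstarMatrix_nonneg_iff_posSemidef _).2 ?_
    exact h

/-! ### Separating an unreachable pair of states -/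

/-- Such matrices are the `Cᴴ * C` with `C` of squared Frobenius norm `c`, and these `C` form a
compact set. -/
theorem isCompact_posSemidef_trace_eq {n : Type*} [Fintype n] [DecidableEq n] (c : ℝ) :
    IsCompact {J : Matrix n n ℂ | J.PosSemidef ∧ J.trace = c} := by
  have hK : IsCompact {C : Matrix n n ℂ | ∑ j, ∑ i, ‖C i j‖ ^ 2 = c} := by
    have hbig : IsCompact {C : Matrix n n ℂ | ∀ i j, C i j ∈ Metric.closedBall (0 : ℂ) √c} := by
      have := isCompact_univ_pi (X := fun _ : n => n → ℂ)
        (s := fun _ => Set.univ.pi fun _ => Metric.closedBall (0 : ℂ) √c)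
        fun _ => isCompact_univ_pi fun _ => isCompact_closedBall _ _
      simpa only [Set.pi, Set.mem_univ, true_imp_iff, Set.mem_ofPred_eq] using! this
    refine hbig.of_isClosed_subset (isClosed_eq (by fun_prop) continuous_const) ?_
    intro C hC i j
    have h1 : ‖C i j‖ ^ 2 ≤ c := by
      rw [← (hC : _ = c)]
      refine (Finset.single_le_sum (f := fun i => ‖C i j‖ ^ 2) (fun _ _ => by positivity)
        (Finset.mem_univ i)).trans ?_
      exact Finset.single_le_sum (f := fun j => ∑ i, ‖C i j‖ ^ 2)
        (fun _ _ => Finset.sum_nonneg fun _ _ => by positivity) (Finset.mem_univ j)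
    rw [mem_closedBall_zero_iff]
    exact Real.le_sqrt_of_sq_le h1
  have himg : {J : Matrix n n ℂ | J.PosSemidef ∧ J.trace = c} =
      (fun C => C.conjTranspose * C) '' {C : Matrix n n ℂ | ∑ j, ∑ i, ‖C i j‖ ^ 2 = c} := by
    have htr : ∀ C : Matrix n n ℂ,
        (C.conjTranspose * C).trace = ((∑ j, ∑ i, ‖C i j‖ ^ 2 : ℝ) : ℂ) := by
      intro C
      simp [Matrix.trace, Matrix.mul_apply, ← Complex.normSq_eq_conj_mul_self,
        Complex.normSq_eq_norm_sq]
    ext J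
    constructor
    · rintro ⟨h1, h2⟩
      obtain ⟨C, hC⟩ := CStarAlgebra.nonneg_iff_eq_star_mul_self.1
        (Matrix.nonneg_iff_posSemidef.2 h1)
      refine ⟨C, ?_, hC.symm⟩
      rw [hC] at h2
      exact_mod_cast (htr C).symm.trans h2
    · rintro ⟨C, hC, rfl⟩
      refine ⟨Matrix.posSemidef_conjTranspose_mul_self _, ?_⟩
      dsimp only
      rw [htr, (hC : _ = c)]
  rw [himg]
  exact hK.image (by fun_prop)

/-- The bilinear (not sesquilinear) pairing `∑ i j, A i j * X i j = Tr (A * Xᵀ)` of matrices. -/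
def matrixPairing {m n : Type*} [Fintype m] [Fintype n] (A X : Matrix m n ℂ) : ℂ :=
  ∑ i, ∑ j, A i j * X i j

theorem matrixPairing_sum_left {m n ι : Type*} [Fintype m] [Fintype n] (s : Finset ι)
    (A : ι → Matrix m n ℂ) (X : Matrix m n ℂ) :
    matrixPairing (∑ x ∈ s, A x) X = ∑ x ∈ s, matrixPairing (A x) X := by
  simp only [matrixPairing, Matrix.sum_apply, Finset.sum_mul]
  rw [Finset.sum_comm]
  simp only [Finset.sum_comm (s := s)]
  rw [Finset.sum_comm]

theorem matrixPairing_add_left {m n : Type*} [Fintype m] [Fintype n] (A B X : Matrix m n ℂ) :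
    matrixPairing (A + B) X = matrixPairing A X + matrixPairing B X := by
  simp only [matrixPairing, Matrix.add_apply, add_mul, Finset.sum_add_distrib]

theorem matrixPairing_smul_left {m n : Type*} [Fintype m] [Fintype n] (c : ℂ)
    (A X : Matrix m n ℂ) : matrixPairing (c • A) X = c * matrixPairing A X := by
  simp only [matrixPairing, Matrix.smul_apply, smul_eq_mul, mul_assoc, Finset.mul_sum]

theorem matrixPairing_smul_right {m n : Type*} [Fintype m] [Fintype n] (c : ℂ)
    (A X : Matrix m n ℂ) : matrixPairing A (c • X) = c * matrixPairing A X := by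
  simp only [matrixPairing, Matrix.smul_apply, smul_eq_mul, mul_left_comm, Finset.mul_sum]

theorem matrixPairing_one_right {n : Type*} [Fintype n] [DecidableEq n] (A : Matrix n n ℂ) :
    matrixPairing A 1 = A.trace := by
  simp [matrixPairing, Matrix.one_apply, Matrix.trace]

theorem matrixPairing_one_left {n : Type*} [Fintype n] [DecidableEq n] (A : Matrix n n ℂ) :
    matrixPairing 1 A = A.trace := by
  simp [matrixPairing, Matrix.one_apply, Matrix.trace]

theorem matrixPairing_conjTranspose {n : Type*} [Fintype n] (A : Matrix n n ℂ)
    {X : Matrix n n ℂ} (hX : X.IsHermitian) :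
    matrixPairing A.conjTranspose X = star (matrixPairing A X) := by
  simp only [matrixPairing, star_sum, star_mul', Matrix.conjTranspose_apply, hX.apply]
  rw [Finset.sum_comm]

theorem matrixPairing_vecMulVec {n : Type*} [Fintype n] (A : Matrix n n ℂ) (w : n → ℂ) :
    matrixPairing A (Matrix.vecMulVec (star w) w) = star w ⬝ᵥ A.mulVec w := by
  simp only [matrixPairing, Matrix.vecMulVec_apply, dotProduct, Matrix.mulVec, Finset.mul_sum,
    mul_left_comm]

/-- Pairing with a Kronecker product evaluates the map with the given Choi matrix. -/
theorem matrixPairing_kronecker {Q Q' : Type*} [Fintype Q] [Fintype Q'] (A : Matrix Q' Q' ℂ)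
    (X : Matrix Q Q ℂ) (J : Matrix (Q' × Q) (Q' × Q) ℂ) :
    matrixPairing (A ⊗ₖ X) J = matrixPairing A (choiMap J X) := by
  simp only [matrixPairing, Fintype.sum_prod_type, choiMap_apply, Matrix.kroneckerMap_apply,
    Finset.mul_sum]
  refine Finset.sum_congr rfl fun i _ => ?_
  rw [Finset.sum_comm]
  exact Finset.sum_congr rfl fun j _ => Finset.sum_congr rfl fun k _ =>
    Finset.sum_congr rfl fun l _ => by ring

theorem matrixPairing_one_kronecker {Q Q' : Type*} [Fintype Q] [Fintype Q'] [DecidableEq Q']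
    (S : Matrix Q Q ℂ) (J : Matrix (Q' × Q) (Q' × Q) ℂ) :
    matrixPairing ((1 : Matrix Q' Q' ℂ) ⊗ₖ S) J = matrixPairing S (partialTrace J) := by
  simp only [matrixPairing, Fintype.sum_prod_type, Matrix.kroneckerMap_apply, Matrix.one_apply,
    ite_mul, one_mul, zero_mul, Finset.sum_ite_irrel, Finset.sum_const_zero, Finset.sum_ite_eq,
    Finset.mem_univ, if_true, partialTrace, Matrix.of_apply, Finset.mul_sum]
  rw [Finset.sum_comm]
  exact Finset.sum_congr rfl fun k _ => Finset.sum_comm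

theorem LinearMap.eq_matrixPairing {m n : Type*} [Fintype m] [Fintype n] [DecidableEq m]
    [DecidableEq n] (g : Matrix m n ℂ →ₗ[ℂ] ℂ) (X : Matrix m n ℂ) :
    g X = matrixPairing (Matrix.of fun i j => g (Matrix.single i j 1)) X := by
  conv_lhs => rw [Matrix.matrix_eq_sum_single X]
  simp only [map_sum, matrixPairing, Matrix.of_apply]
  refine Finset.sum_congr rfl fun i _ => Finset.sum_congr rfl fun j _ => ?_
  rw [mul_comm, ← smul_eq_mul, ← map_smul, Matrix.smul_single, smul_eq_mul, mul_one]

/-- The Hermitian part of a matrix. -/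
noncomputable def hermitianPart {n : Type*} (A : Matrix n n ℂ) : Matrix n n ℂ :=
  (1 / 2 : ℂ) • (A + A.conjTranspose)

theorem isHermitian_hermitianPart {n : Type*} (A : Matrix n n ℂ) :
    (hermitianPart A).IsHermitian := by
  rw [Matrix.IsHermitian, hermitianPart, Matrix.conjTranspose_smul, Matrix.conjTranspose_add,
    Matrix.conjTranspose_conjTranspose, add_comm]
  congr 1
  simp

theorem re_matrixPairing_hermitianPart {n : Type*} [Fintype n] (A : Matrix n n ℂ)
    {X : Matrix n n ℂ} (hX : X.IsHermitian) :
    (matrixPairing (hermitianPart A) X).re = (matrixPairing A X).re := by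
  rw [hermitianPart, matrixPairing_smul_left, matrixPairing_add_left,
    matrixPairing_conjTranspose A hX, Complex.star_def, Complex.add_conj]
  simp

theorem isHermitian_choiMap {Q Q' : Type*} [Fintype Q] {J : Matrix (Q' × Q) (Q' × Q) ℂ}
    (hJ : J.IsHermitian) {X : Matrix Q Q ℂ} (hX : X.IsHermitian) : (choiMap J X).IsHermitian := by
  ext i j
  simp only [Matrix.conjTranspose_apply, choiMap_apply, star_sum, star_mul', hJ.apply, hX.apply]
  exact Finset.sum_comm

theorem isHermitian_partialTrace {Q Q' : Type*} [Fintype Q'] {J : Matrix (Q' × Q) (Q' × Q) ℂ}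
    (hJ : J.IsHermitian) : (partialTrace J).IsHermitian := by
  ext k l
  simp only [Matrix.conjTranspose_apply, partialTrace, Matrix.of_apply, star_sum, hJ.apply]

theorem trace_partialTrace {Q Q' : Type*} [Fintype Q] [Fintype Q']
    (J : Matrix (Q' × Q) (Q' × Q) ℂ) : (partialTrace J).trace = J.trace := by
  simp only [Matrix.trace, Matrix.diag, partialTrace, Matrix.of_apply, Fintype.sum_prod_type]
  exact Finset.sum_comm

theorem isHermitian_kronecker {m n : Type*} {A : Matrix m m ℂ} {B : Matrix n n ℂ}
    (hA : A.IsHermitian) (hB : B.IsHermitian) : (A ⊗ₖ B).IsHermitian := by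
  rw [Matrix.IsHermitian, Matrix.conjTranspose_kronecker, hA.eq, hB.eq]

/-- If no channel maps every `ρ x` to `σ x`, then some `S` and Hermitian `T x` certify this: every
channel `Φ` satisfies `∑ x, Tr (T x * (Φ (ρ x))ᵀ) ≤ Tr S`, by the positivity of
`1 ⊗ S - ∑ x, T x ⊗ ρ x`, while the same sum for `σ` exceeds `Tr S`. -/
theorem exists_separating_observables {Q Q' ι : Type*} [Fintype Q] [DecidableEq Q] [Fintype Q']
    [DecidableEq Q'] [Fintype ι] [Nonempty Q] {ρ : ι → Matrix Q Q ℂ} {σ : ι → Matrix Q' Q' ℂ}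
    (hρ : ∀ x, (ρ x).IsHermitian) (hσ : ∀ x, (σ x).IsHermitian)
    (h : ¬∃ J : Matrix (Q' × Q) (Q' × Q) ℂ,
      J.PosSemidef ∧ (∀ x, choiMap J (ρ x) = σ x) ∧ partialTrace J = 1) :
    ∃ (T : ι → Matrix Q' Q' ℂ) (S : Matrix Q Q ℂ), (∀ x, (T x).IsHermitian) ∧
      ((1 : Matrix Q' Q' ℂ) ⊗ₖ S - ∑ x, T x ⊗ₖ ρ x).PosSemidef ∧
      S.trace.re < ∑ x, (matrixPairing (T x) (σ x)).re := by
  classical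
  set d : ℝ := (Fintype.card Q : ℝ) with hd
  have hd0 : 0 < d := by rw [hd]; exact_mod_cast Fintype.card_pos
  let F : Matrix (Q' × Q) (Q' × Q) ℂ →ₗ[ℝ] (ι → Matrix Q' Q' ℂ) × Matrix Q Q ℂ :=
    { toFun := fun J => (fun x => choiMap J (ρ x), partialTrace J)
      map_add' := by
        intro J K
        refine Prod.ext (funext fun x => ?_) ?_
        · ext i j
          simp [choiMap_apply, add_mul, Finset.sum_add_distrib]
        · ext k l
          simp [partialTrace, Finset.sum_add_distrib]
      map_smul' := by
        intro c J
        refine Prod.ext (funext fun x => ?_) ?_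
        · ext i j
          simp [choiMap_apply, Finset.mul_sum, mul_assoc]
        · ext k l
          simp [partialTrace, Finset.mul_sum] }
  let B : Set (Matrix (Q' × Q) (Q' × Q) ℂ) := {J | J.PosSemidef ∧ J.trace = d}
  have hBconv : Convex ℝ B := by
    rintro J ⟨hJ, hJ'⟩ K ⟨hK, hK'⟩ a b ha hb hab
    refine ⟨(hJ.smul ha).add (hK.smul hb), ?_⟩
    rw [Matrix.trace_add, Matrix.trace_smul, Matrix.trace_smul, hJ', hK', ← add_smul, hab, one_smul]
  have hFcont : Continuous F := F.continuous_of_finiteDimensional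
  have hz : ((σ, 1) : (ι → Matrix Q' Q' ℂ) × Matrix Q Q ℂ) ∉ F '' B := by
    rintro ⟨J, hJ, hJF⟩
    have h1 := congrArg Prod.fst hJF
    exact h ⟨J, hJ.1, fun x => congrFun h1 x, congrArg Prod.snd hJF⟩
  obtain ⟨f, u, hfu, huf⟩ := RCLike.geometric_hahn_banach_closed_point (𝕜 := ℂ)
    (hBconv.linear_image F) ((isCompact_posSemidef_trace_eq d).image hFcont).isClosed hz
  let A : ι → Matrix Q' Q' ℂ := fun x => Matrix.of fun i j =>
    f (Pi.single x (Matrix.single i j 1), 0)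
  let G : Matrix Q Q ℂ := Matrix.of fun k l => f (0, Matrix.single k l 1)
  have hf : ∀ X Y, f (X, Y) = ∑ x, matrixPairing (A x) (X x) + matrixPairing G Y := by
    intro X Y
    have e : ((X, Y) : (ι → Matrix Q' Q' ℂ) × Matrix Q Q ℂ) =
        ∑ x, (Pi.single x (X x), 0) + (0, Y) := by
      refine Prod.ext ?_ ?_
      · simp [Prod.fst_sum, Finset.univ_sum_single]
      · simp [Prod.snd_sum]
    rw [e, map_add, map_sum]
    congr 1
    · refine Finset.sum_congr rfl fun x _ => ?_
      exact LinearMap.eq_matrixPairing (f.toLinearMap ∘ₗ LinearMap.inl ℂ _ _ ∘ₗ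
        LinearMap.single ℂ (fun _ : ι => Matrix Q' Q' ℂ) x) (X x)
    · exact LinearMap.eq_matrixPairing (f.toLinearMap ∘ₗ LinearMap.inr ℂ _ _) Y
  -- Subtracting the multiple `u / d` of the trace moves the separating hyperplane to the origin,
  -- so that the bound on `B` extends to the cone over `B`.
  let S : Matrix Q Q ℂ := ((u / d : ℝ) : ℂ) • (1 : Matrix Q Q ℂ) + (-1 : ℂ) • hermitianPart G
  let T : ι → Matrix Q' Q' ℂ := fun x => hermitianPart (A x)
  have hSherm : S.IsHermitian := by
    refine Matrix.IsHermitian.add ?_ ?_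
    · rw [Matrix.IsHermitian, Matrix.conjTranspose_smul, Matrix.conjTranspose_one]
      simp
    · rw [Matrix.IsHermitian, Matrix.conjTranspose_smul, (isHermitian_hermitianPart G).eq]
      simp
  have hSpair : ∀ Y : Matrix Q Q ℂ, Y.IsHermitian →
      (matrixPairing S Y).re = u / d * Y.trace.re - (matrixPairing G Y).re := by
    intro Y hY
    rw [matrixPairing_add_left, matrixPairing_smul_left, matrixPairing_smul_left,
      matrixPairing_one_left, Complex.add_re, Complex.re_ofReal_mul, neg_one_mul, Complex.neg_re,
      re_matrixPairing_hermitianPart G hY, sub_eq_add_neg]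
  set M : Matrix (Q' × Q) (Q' × Q) ℂ := (1 : Matrix Q' Q' ℂ) ⊗ₖ S + (-1 : ℂ) • ∑ x, T x ⊗ₖ ρ x
    with hM
  have hMpair : ∀ J ∈ B, 0 ≤ (matrixPairing M J).re := by
    intro J hJ
    have h1 := hfu _ ⟨J, hJ, rfl⟩
    change (f (fun x => choiMap J (ρ x), partialTrace J)).re < u at h1
    rw [hf, Complex.add_re, Complex.re_sum] at h1
    rw [hM, matrixPairing_add_left, matrixPairing_smul_left, matrixPairing_one_kronecker,
      matrixPairing_sum_left, neg_one_mul, Complex.add_re, Complex.neg_re, Complex.re_sum,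
      hSpair _ (isHermitian_partialTrace hJ.1.1), trace_partialTrace, hJ.2, Complex.ofReal_re,
      div_mul_cancel₀ _ hd0.ne']
    simp only [matrixPairing_kronecker, T,
      re_matrixPairing_hermitianPart _ (isHermitian_choiMap hJ.1.1 (hρ _))]
    linarith
  refine ⟨T, S, fun x => isHermitian_hermitianPart _, ?_, ?_⟩
  · have hMherm : M.IsHermitian := by
      refine Matrix.IsHermitian.add (isHermitian_kronecker Matrix.isHermitian_one hSherm) ?_
      rw [Matrix.IsHermitian, Matrix.conjTranspose_smul, Matrix.conjTranspose_sum]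
      congr 1
      · simp
      · exact Finset.sum_congr rfl fun x _ =>
          isHermitian_kronecker (isHermitian_hermitianPart _) (hρ x)
    have hMsub : (1 : Matrix Q' Q' ℂ) ⊗ₖ S - ∑ x, T x ⊗ₖ ρ x = M := by
      rw [hM, neg_one_smul, sub_eq_add_neg]
    rw [hMsub]
    refine Matrix.PosSemidef.of_dotProduct_mulVec_nonneg hMherm fun w => ?_
    have him := hMherm.im_star_dotProduct_mulVec_self w
    rw [Complex.le_def]
    refine ⟨?_, him.symm⟩
    rw [Complex.zero_re]
    by_cases hw : w = 0
    · simp [hw]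
    have hN : 0 < ∑ i, ‖w i‖ ^ 2 := by
      obtain ⟨i, hi⟩ := Function.ne_iff.1 hw
      exact Finset.sum_pos' (fun _ _ => by positivity)
        ⟨i, Finset.mem_univ i, by have := norm_pos_iff.2 hi; positivity⟩
    set N : ℝ := ∑ i, ‖w i‖ ^ 2 with hNdef
    have hmem : ((d / N : ℝ) : ℂ) • Matrix.vecMulVec (star w) w ∈ B := by
      refine ⟨(Matrix.posSemidef_vecMulVec_star_self w).smul ?_, ?_⟩
      · exact_mod_cast (div_pos hd0 hN).le
      · have ht : (Matrix.vecMulVec (star w) w).trace = (N : ℂ) := by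
          rw [hNdef]
          simp [Matrix.trace, Matrix.vecMulVec_apply, ← Complex.normSq_eq_conj_mul_self,
            Complex.normSq_eq_norm_sq]
        rw [Matrix.trace_smul, ht, smul_eq_mul, ← Complex.ofReal_mul, div_mul_cancel₀ _ hN.ne']
    have h2 := hMpair _ hmem
    rw [matrixPairing_smul_right, matrixPairing_vecMulVec, Complex.re_ofReal_mul] at h2
    exact nonneg_of_mul_nonneg_right h2 (div_pos hd0 hN)
  · change u < (f (σ, 1)).re at huf
    rw [hf, Complex.add_re, Complex.re_sum] at huf
    have h3 := hSpair 1 Matrix.isHermitian_one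
    rw [matrixPairing_one_right, Matrix.trace_one, Complex.natCast_re, ← hd,
      div_mul_cancel₀ _ hd0.ne'] at h3
    rw [h3]
    simp only [T, re_matrixPairing_hermitianPart _ (hσ _)]
    linarith

/-! ### Blocks of the cq-state -/

/-- The unnormalized state on `R ⊗ Q` conditional on the value `u` of the classical register. -/
noncomputable def cqBlock {U Y R Q : Type*} [Fintype Y] (p : U × Y × Fin 2 → ℝ)
    (τ : Y → Matrix R R ℂ) (ρ : Fin 2 → Matrix Q Q ℂ) (u : U) : Matrix (R × Q) (R × Q) ℂ :=
  ∑ x, (∑ y, p (u, y, x) • τ y) ⊗ₖ ρ x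

theorem posSemidef_cqBlock {U Y R Q : Type*} [Fintype Y] [Fintype R] [Fintype Q]
    {p : U × Y × Fin 2 → ℝ} (hp : ∀ z, 0 ≤ p z)
    {τ : Y → Matrix R R ℂ} (hτ : ∀ y, (τ y).PosSemidef) {ρ : Fin 2 → Matrix Q Q ℂ}
    (hρ : ∀ x, (ρ x).PosSemidef) (u : U) : (cqBlock p τ ρ u).PosSemidef := by
  classical
  exact Matrix.posSemidef_sum _ fun x _ => Matrix.PosSemidef.kronecker
    (Matrix.posSemidef_sum _ fun y _ => (hτ y).smul (hp _)) (hρ x)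

section cqState

variable {U Y R Q : Type*} [Fintype U] [DecidableEq U] [Fintype Y]

theorem cqState_eq_sum_single_kronecker (p : U × Y × Fin 2 → ℝ) (τ : Y → Matrix R R ℂ)
    (ρ : Fin 2 → Matrix Q Q ℂ) :
    cqState p τ ρ = ∑ u, Matrix.single u u (1 : ℂ) ⊗ₖ cqBlock p τ ρ u := by
  have hb : ∀ u, cqBlock p τ ρ u = ∑ y, ∑ x, p (u, y, x) • (τ y ⊗ₖ ρ x) := by
    intro u
    ext a b
    simp only [cqBlock, Matrix.sum_apply, Matrix.kroneckerMap_apply, Matrix.smul_apply,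
      Finset.sum_mul, smul_mul_assoc]
    exact Finset.sum_comm
  rw [cqState]
  refine Finset.sum_congr rfl fun u _ => ?_
  rw [hb]
  ext a b
  simp only [Matrix.sum_apply, Matrix.kroneckerMap_apply, Matrix.smul_apply, Finset.mul_sum,
    mul_smul_comm]

theorem sum_single_kronecker_apply {B : Type*} (X : U → Matrix B B ℂ) (u v : U) (a b : B) :
    (∑ w, Matrix.single w w (1 : ℂ) ⊗ₖ X w) (u, a) (v, b) = if u = v then X u a b else 0 := by
  simp only [Matrix.sum_apply, Matrix.kroneckerMap_apply, Matrix.single_apply]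
  rw [Finset.sum_eq_single u]
  · by_cases h : u = v <;> simp [h]
  · intro w _ hw
    simp [hw]
  · simp

theorem posSemidef_single_kronecker {B : Type*} [Fintype B] (u : U) {X : Matrix B B ℂ}
    (hX : X.PosSemidef) : (Matrix.single u u (1 : ℂ) ⊗ₖ X).PosSemidef := by
  classical
  refine Matrix.PosSemidef.kronecker ?_ hX
  have : Matrix.single u u (1 : ℂ) = Matrix.diagonal (Pi.single u 1) := by
    rw [Matrix.diagonal_single]
  rw [this]
  refine Matrix.PosSemidef.diagonal fun v => ?_
  by_cases h : v = u
  · subst h; simp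
  · simp [h]

/-- A block diagonal operator is below `1 ⊗ X` exactly if each of its blocks is below `X`. -/
theorem cqState_le_one_kronecker_iff [Fintype R] [Fintype Q] {p : U × Y × Fin 2 → ℝ}
    {τ : Y → Matrix R R ℂ} {ρ : Fin 2 → Matrix Q Q ℂ} {X : Matrix (R × Q) (R × Q) ℂ} :
    cqState p τ ρ ≤ (1 : Matrix U U ℂ) ⊗ₖ X ↔ ∀ u, cqBlock p τ ρ u ≤ X := by
  have hsub : (1 : Matrix U U ℂ) ⊗ₖ X - cqState p τ ρ =
      ∑ u, Matrix.single u u (1 : ℂ) ⊗ₖ (X - cqBlock p τ ρ u) := by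
    rw [cqState_eq_sum_single_kronecker]
    ext ⟨u, a⟩ ⟨v, b⟩
    rw [Matrix.sub_apply, sum_single_kronecker_apply, sum_single_kronecker_apply,
      Matrix.kroneckerMap_apply, Matrix.one_apply]
    by_cases h : u = v <;> simp [h]
  rw [Matrix.le_iff, hsub]
  constructor
  · intro h u
    have := h.submatrix fun a : R × Q => (u, a)
    rw [Matrix.le_iff]
    convert this using 1
    ext a b
    rw [Matrix.submatrix_apply, sum_single_kronecker_apply, if_pos rfl]
  · intro h
    exact Matrix.posSemidef_sum _ fun u _ => posSemidef_single_kronecker u (Matrix.le_iff.1 (h u))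

theorem isDensityMatrix_cqState [Fintype R] [Fintype Q] {p : U × Y × Fin 2 → ℝ}
    (hp : p ∈ stdSimplex ℝ (U × Y × Fin 2)) {τ : Y → Matrix R R ℂ}
    (hτ : ∀ y, IsDensityMatrix (τ y)) {ρ : Fin 2 → Matrix Q Q ℂ}
    (hρ : ∀ x, IsDensityMatrix (ρ x)) : IsDensityMatrix (cqState p τ ρ) := by
  constructor
  · rw [cqState_eq_sum_single_kronecker]
    exact Matrix.posSemidef_sum _ fun u _ => posSemidef_single_kronecker u
      (posSemidef_cqBlock hp.1 (fun y => (hτ y).1) (fun x => (hρ x).1) u)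
  · simp only [cqState, Matrix.trace_sum, Matrix.trace_smul, Matrix.trace_kronecker,
      Matrix.trace_single_eq_same, (hτ _).2, (hρ _).2, mul_one, Complex.real_smul]
    have := hp.2
    simp only [Fintype.sum_prod_type] at this
    exact_mod_cast this

/-- An operator `X` with `ρ ≤ 1 ⊗ X` need not be normalized to bound the min-entropy of `ρ` from
below; positivity of `X` is automatic. -/
theorem neg_logb_trace_le_condMinEntropy [Fintype R] [Fintype Q] {p : U × Y × Fin 2 → ℝ}
    (hp : p ∈ stdSimplex ℝ (U × Y × Fin 2)) {τ : Y → Matrix R R ℂ}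
    (hτ : ∀ y, IsDensityMatrix (τ y)) {ρ : Fin 2 → Matrix Q Q ℂ}
    (hρ : ∀ x, IsDensityMatrix (ρ x)) {X : Matrix (R × Q) (R × Q) ℂ}
    (hX : ∀ u, cqBlock p τ ρ u ≤ X) :
    0 < X.trace.re ∧ -Real.logb 2 X.trace.re ≤ condMinEntropy (cqState p τ ρ) := by
  have hdens := isDensityMatrix_cqState hp hτ hρ
  have hle := cqState_le_one_kronecker_iff.2 hX
  have htr := (Matrix.le_iff.1 hle).trace_nonneg
  rw [Matrix.trace_sub, Matrix.trace_kronecker, hdens.trace_eq_one, Matrix.trace_one,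
    sub_nonneg, ← Complex.ofReal_natCast, Complex.le_def, Complex.re_ofReal_mul] at htr
  have hU : Nonempty U := by
    by_contra h
    rw [not_nonempty_iff] at h
    have := hp.2
    simp at this
  obtain ⟨u₀⟩ := hU
  have hXpos : X.PosSemidef := by
    rw [← Matrix.nonneg_iff_posSemidef]
    exact (Matrix.nonneg_iff_posSemidef.2 (posSemidef_cqBlock hp.1 (fun y => (hτ y).1)
      (fun x => (hρ x).1) u₀)).trans (hX u₀)
  have hpos : 0 < X.trace.re := by
    by_contra h
    have h1 := mul_nonpos_of_nonneg_of_nonpos (Nat.cast_nonneg (α := ℝ) (Fintype.card U))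
      (not_lt.1 h)
    have h2 := htr.1
    rw [Complex.one_re] at h2
    linarith
  refine ⟨hpos, le_csSup (minEntropySet_bddAbove hdens) ?_⟩
  have him : (X.trace.re : ℂ) = X.trace := by
    refine Complex.ext rfl ?_
    exact (Complex.le_def.1 hXpos.trace_nonneg).2
  refine ⟨(X.trace.re)⁻¹ • X, ⟨hXpos.smul (inv_nonneg.2 hpos.le), ?_⟩, ?_⟩
  · rw [Matrix.trace_smul, Complex.real_smul, ← him, Complex.ofReal_re, ← Complex.ofReal_mul,
      inv_mul_cancel₀ hpos.ne', Complex.ofReal_one]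
  · rw [neg_neg, Real.rpow_logb (by norm_num) (by norm_num) hpos, Matrix.kronecker_smul, smul_smul,
      mul_inv_cancel₀ hpos.ne', one_smul]
    exact hle

end cqState

/-- A channel, applied to the quantum system `Q`, does not decrease the min-entropy of the
classical register. -/
theorem condMinEntropy_cqState_le {U Y R Q Q' : Type*} [Fintype U] [DecidableEq U] [Fintype Y]
    [Fintype R] [Fintype Q] [DecidableEq Q] [Fintype Q'] [DecidableEq Q']
    (Φ : Matrix Q Q ℂ →CP Matrix Q' Q' ℂ) (hΦ : ∀ A, (Φ A).trace = A.trace)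
    {p : U × Y × Fin 2 → ℝ} (hp : p ∈ stdSimplex ℝ (U × Y × Fin 2)) {τ : Y → Matrix R R ℂ}
    (hτ : ∀ y, IsDensityMatrix (τ y)) {ρ : Fin 2 → Matrix Q Q ℂ} {σ : Fin 2 → Matrix Q' Q' ℂ}
    (hρ : ∀ x, IsDensityMatrix (ρ x)) (hσ : ∀ x, IsDensityMatrix (σ x))
    (h : ∀ x, Φ (ρ x) = σ x) :
    condMinEntropy (cqState p τ ρ) ≤ condMinEntropy (cqState p τ σ) := by
  refine csSup_le_csSup (minEntropySet_bddAbove (isDensityMatrix_cqState hp hτ hσ))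
    (minEntropySet_nonempty (isDensityMatrix_cqState hp hτ hρ)) ?_
  rintro l ⟨s, hs, hle⟩
  refine ⟨ampliation R Φ.toLinearMap s, ⟨posSemidef_ampliation Φ hs.1, ?_⟩, ?_⟩
  · rw [trace_ampliation hΦ, hs.2]
  · rw [← Matrix.kronecker_smul, cqState_le_one_kronecker_iff] at hle ⊢
    intro u
    have hblock : ampliation R Φ.toLinearMap (cqBlock p τ ρ u) = cqBlock p τ σ u := by
      rw [cqBlock, map_sum, cqBlock]
      refine Finset.sum_congr rfl fun x _ => ?_
      rw [ampliation_kronecker, ← h x]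
      rfl
    have h1 := posSemidef_ampliation Φ (Matrix.le_iff.1 (hle u))
    rw [map_sub, LinearMap.map_smul_of_tower, hblock] at h1
    exact Matrix.le_iff.2 h1

/-! ### Maximally entangled measurements -/

/-- For an abelian group `G`, the Weyl operators (shift by `k`, phases given by the character `ψ`)
as unitaries from the space with basis `Q` to the one with basis `G`. -/
noncomputable def weylOperator {G Q : Type*} [AddCommGroup G] [DecidableEq G] (e : Q ≃ G)
    (u : G × AddChar G ℂ) : Matrix G Q ℂ :=
  Matrix.of fun a i => if a = e i + u.1 then u.2 (e i) else 0

/-- The vector `∑ a i, W a i |a⟩ ⊗ |i⟩` with the entries of a matrix `W`. -/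
def matrixVec {m n : Type*} (W : Matrix m n ℂ) : m × n → ℂ := fun z => W z.1 z.2

theorem star_matrixVec_dotProduct_kronecker {m n : Type*} [Fintype m] [Fintype n]
    (W : Matrix m n ℂ) (A : Matrix m m ℂ) (X : Matrix n n ℂ) :
    star (matrixVec W) ⬝ᵥ (A ⊗ₖ X).mulVec (matrixVec W) =
      matrixPairing (W.conjTranspose * A * W) X := by
  simp only [dotProduct, Matrix.mulVec, matrixPairing, Fintype.sum_prod_type, matrixVec,
    Matrix.mul_apply, Matrix.conjTranspose_apply, Matrix.kroneckerMap_apply, Pi.star_apply,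
    Finset.mul_sum, Finset.sum_mul]
  rw [Finset.sum_comm]
  refine Finset.sum_congr rfl fun i _ => ?_
  rw [Finset.sum_comm]
  conv_rhs => rw [Finset.sum_comm]
  refine Finset.sum_congr rfl fun b _ => ?_
  rw [Finset.sum_comm]
  exact Finset.sum_congr rfl fun j _ => Finset.sum_congr rfl fun a _ => by ring

theorem conjTranspose_mul_weylOperator {G Q : Type*} [AddCommGroup G] [Fintype G]
    [DecidableEq G] [DecidableEq Q] (e : Q ≃ G) (u : G × AddChar G ℂ) :
    (weylOperator e u).conjTranspose * weylOperator e u = 1 := by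
  ext i j
  simp only [Matrix.mul_apply, Matrix.conjTranspose_apply, weylOperator, Matrix.of_apply,
    Matrix.one_apply, mul_ite, mul_zero, Finset.sum_ite_eq', Finset.mem_univ,
    if_true, add_left_inj, e.injective.eq_iff, eq_comm (a := j)]
  by_cases h : i = j
  · subst h
    rw [if_pos rfl, if_pos rfl, Complex.star_def, ← Complex.normSq_eq_conj_mul_self,
      Complex.normSq_eq_norm_sq, u.2.norm_apply]
    simp
  · simp [h]

section Weyl

variable {G Q : Type*} [AddCommGroup G] [Fintype G] [DecidableEq G] [Fintype Q] [DecidableEq Q]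

theorem weylOperator_mul_conjTranspose (e : Q ≃ G) (u : G × AddChar G ℂ) :
    weylOperator e u * (weylOperator e u).conjTranspose = 1 :=
  (Matrix.mul_eq_one_comm_of_equiv e).1 (conjTranspose_mul_weylOperator e u)

/-- Orthogonality of characters: the vectors with the entries of the Weyl operators are an
orthogonal basis of `ℂᴳ ⊗ ℂ^Q`. -/
theorem sum_star_weylOperator_mul (e : Q ≃ G) (a b : G) (i j : Q) :
    ∑ u, star (weylOperator e u a i) * weylOperator e u b j =
      if a = b ∧ i = j then (Fintype.card Q : ℂ) else 0 := by
  have hψ : ∀ ψ : AddChar G ℂ, star (ψ (e i)) * ψ (e j) = ψ (e j - e i) := by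
    intro ψ
    rw [AddChar.map_sub_eq_div, div_eq_mul_inv, AddChar.inv_apply_eq_conj, mul_comm]
    rfl
  have hk : ∀ (a k : G) (i : Q), (a = e i + k) ↔ (k = a - e i) := fun a k i => by
    rw [eq_sub_iff_add_eq', eq_comm]
  simp only [weylOperator, Matrix.of_apply, Fintype.sum_prod_type, apply_ite star, star_zero,
    ite_mul, zero_mul, mul_ite, mul_zero, Finset.sum_ite_irrel, Finset.sum_const_zero, hψ,
    AddChar.sum_apply_eq_ite, hk, Fintype.card_congr e, sub_eq_zero, e.injective.eq_iff]
  by_cases hij : i = j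
  · subst hij
    simp only [if_true, and_true, Finset.sum_ite_eq', Finset.mem_univ, sub_left_inj,
      eq_comm (a := b)]
  · simp [hij, Ne.symm hij]

theorem sum_star_matrixVec_weylOperator (e : Q ≃ G) (M : Matrix (G × Q) (G × Q) ℂ) :
    ∑ u, star (matrixVec (weylOperator e u)) ⬝ᵥ M.mulVec (matrixVec (weylOperator e u)) =
      Fintype.card Q * M.trace := by
  have h : ∀ z w : G × Q, ∑ u, star (matrixVec (weylOperator e u)) z *
      matrixVec (weylOperator e u) w = if z = w then (Fintype.card Q : ℂ) else 0 := by
    intro z w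
    rw [if_congr Prod.ext_iff rfl rfl]
    exact sum_star_weylOperator_mul e z.1 w.1 z.2 w.2
  calc _ = ∑ z, ∑ w, M z w * ∑ u, star (matrixVec (weylOperator e u)) z *
      matrixVec (weylOperator e u) w := by
        simp only [dotProduct, Matrix.mulVec, Finset.mul_sum]
        rw [Finset.sum_comm]
        refine Finset.sum_congr rfl fun z _ => ?_
        rw [Finset.sum_comm]
        exact Finset.sum_congr rfl fun w _ => Finset.sum_congr rfl fun u _ => by ring
    _ = _ := by
        simp only [h, mul_ite, mul_zero, Finset.sum_ite_eq, Finset.mem_univ, if_true,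
          ← Finset.sum_mul, Matrix.trace, Matrix.diag]
        exact mul_comm _ _

end Weyl

/-- Measuring in the orthonormal basis of the normalized vectors `matrixVec (W u) / √(dim Q)`
guesses the classical register with a probability of at most `2 ^ (-l)`. -/
theorem sum_weylOperator_le_of_mem_minEntropySet {G Q Y : Type*} [AddCommGroup G] [Fintype G]
    [DecidableEq G] [Fintype Q] [DecidableEq Q] [Fintype Y] [DecidableEq (AddChar G ℂ)] (e : Q ≃ G)
    {p : (G × AddChar G ℂ) × Y × Fin 2 → ℝ} {τ : Y → Matrix G G ℂ} {σ : Fin 2 → Matrix Q Q ℂ}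
    {l : ℝ} (hl : l ∈ minEntropySet (cqState p τ σ)) :
    (∑ u, star (matrixVec (weylOperator e u)) ⬝ᵥ
      (cqBlock p τ σ u).mulVec (matrixVec (weylOperator e u))).re ≤
        Fintype.card Q * (2 : ℝ) ^ (-l) := by
  obtain ⟨s, hs, hle⟩ := hl
  rw [← Matrix.kronecker_smul, cqState_le_one_kronecker_iff] at hle
  have h1 := Finset.sum_nonneg fun u (_ : u ∈ Finset.univ) =>
    (Matrix.le_iff.1 (hle u)).dotProduct_mulVec_nonneg (matrixVec (weylOperator e u))
  simp only [Matrix.sub_mulVec, dotProduct_sub, Finset.sum_sub_distrib] at h1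
  rw [sum_star_matrixVec_weylOperator, sub_nonneg, Matrix.trace_smul, hs.2] at h1
  have h2 := (Complex.le_def.1 h1).1
  simpa using h2

/-! ### Complete cq-channels -/

theorem span_isDensityMatrix_eq_top (R : Type*) [Fintype R] :
    Submodule.span ℂ {τ : Matrix R R ℂ | IsDensityMatrix τ} = ⊤ := by
  classical
  rw [eq_top_iff, ← CStarAlgebra.span_nonneg, Submodule.span_le]
  intro A hA
  have hA' : A.PosSemidef := Matrix.nonneg_iff_posSemidef.1 hA
  by_cases h0 : A.trace = 0
  · rw [hA'.trace_eq_zero_iff.1 h0]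
    exact Submodule.zero_mem _
  · have hmem : A.trace⁻¹ • A ∈ Submodule.span ℂ {τ : Matrix R R ℂ | IsDensityMatrix τ} := by
      refine Submodule.subset_span ⟨hA'.smul (inv_nonneg.2 hA'.trace_nonneg), ?_⟩
      rw [Matrix.trace_smul, smul_eq_mul, inv_mul_cancel₀ h0]
    have := Submodule.smul_mem _ A.trace hmem
    rwa [smul_smul, mul_inv_cancel₀ h0, one_smul] at this

theorem exists_isCompleteCQChannel (R : Type) [Fintype R] :
    ∃ (Y : Type) (_ : Fintype Y) (τ : Y → Matrix R R ℂ), IsCompleteCQChannel τ := by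
  classical
  obtain ⟨b, hb, hspan, hli⟩ :=
    exists_linearIndependent ℂ {τ : Matrix R R ℂ | IsDensityMatrix τ}
  have htop : Submodule.span ℂ (Set.range ((↑) : b → Matrix R R ℂ)) = ⊤ := by
    rw [Subtype.range_coe, hspan, span_isDensityMatrix_eq_top]
  have : Finite b := hli.finite
  have := Fintype.ofFinite b
  refine ⟨b, inferInstance, (↑), fun y => hb y.2, ?_, htop⟩
  rw [← Module.finrank_eq_card_basis (Module.Basis.mk hli htop.ge), Module.finrank_matrix]
  simp [sq]

theorem IsCompleteCQChannel.exists_real_coeff {R Y : Type*} [Fintype R] [Fintype Y]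
    {τ : Y → Matrix R R ℂ} (hτ : IsCompleteCQChannel τ) {A : Matrix R R ℂ} (hA : A.IsHermitian) :
    ∃ c : Y → ℝ, ∑ y, c y • τ y = A := by
  have hmem : A ∈ Submodule.span ℂ (Set.range τ) := by rw [hτ.span_eq_top]; trivial
  obtain ⟨c, hc⟩ := Submodule.mem_span_range_iff_exists_fun ℂ |>.1 hmem
  refine ⟨fun y => (c y).re, ?_⟩
  have hc' : ∑ y, star (c y) • τ y = A := by
    conv_rhs => rw [← hA.eq, ← hc, Matrix.conjTranspose_sum]
    refine Finset.sum_congr rfl fun y _ => ?_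
    rw [Matrix.conjTranspose_smul, (hτ.isDensityMatrix y).1.1.eq]
  have hre : ∀ y, (c y).re • τ y = (1 / 2 : ℂ) • (c y • τ y + star (c y) • τ y) := by
    intro y
    rw [← add_smul, Complex.star_def, Complex.add_conj, smul_smul, ← Complex.coe_smul]
    congr 1
    push_cast
    ring
  rw [Finset.sum_congr rfl fun y _ => hre y, ← Finset.smul_sum, Finset.sum_add_distrib, hc, hc',
    ← two_smul ℂ A, smul_smul]
  norm_num

/-- Up to a positive factor and a common shift `D`, every finite family of Hermitian operators is
produced by a probability distribution on the inputs of a complete cq-channel. -/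
theorem IsCompleteCQChannel.exists_distribution {U R Y : Type*} [Fintype U] [Nonempty U]
    [Fintype R] [Nonempty R] [Fintype Y] {τ : Y → Matrix R R ℂ} (hτ : IsCompleteCQChannel τ)
    {O : U → Fin 2 → Matrix R R ℂ} (hO : ∀ u x, (O u x).IsHermitian) :
    ∃ p ∈ stdSimplex ℝ (U × Y × Fin 2), ∃ z : ℝ, 0 < z ∧ ∃ D : Matrix R R ℂ,
      ∀ u x, ∑ y, p (u, y, x) • τ y = z • O u x + D := by
  have hY : Nonempty Y := by
    rw [← Fintype.card_pos_iff, hτ.card_eq]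
    exact pow_pos Fintype.card_pos 2
  choose c hc using fun u x => hτ.exists_real_coeff (hO u x)
  let K : ℝ := ∑ w : U × Y × Fin 2, |c w.1 w.2.2 w.2.1| + 1
  let q : U × Y × Fin 2 → ℝ := fun w => c w.1 w.2.2 w.2.1 + K
  have hq : ∀ w, 0 < q w := by
    intro w
    have h1 := Finset.single_le_sum (f := fun w : U × Y × Fin 2 => |c w.1 w.2.2 w.2.1|)
      (fun _ _ => abs_nonneg _) (Finset.mem_univ w)
    have h2 := neg_abs_le (c w.1 w.2.2 w.2.1)
    simp only [q, K]
    linarith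
  have hZ : 0 < ∑ w, q w := Finset.sum_pos (fun w _ => hq w) Finset.univ_nonempty
  refine ⟨fun w => (∑ w, q w)⁻¹ * q w, ⟨fun w => (mul_pos (inv_pos.2 hZ) (hq w)).le, ?_⟩,
    (∑ w, q w)⁻¹, inv_pos.2 hZ, (∑ w, q w)⁻¹ • K • ∑ y, τ y, fun u x => ?_⟩
  · rw [← Finset.mul_sum, inv_mul_cancel₀ hZ.ne']
  · simp only [mul_smul, ← Finset.smul_sum, q, add_smul, Finset.sum_add_distrib, hc, smul_add]

/-! ### From the order to a channel -/

theorem IsDensityMatrix.nonempty {n : Type*} [Fintype n] {ρ : Matrix n n ℂ}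
    (hρ : IsDensityMatrix ρ) : Nonempty n := by
  by_contra h
  rw [not_nonempty_iff] at h
  simpa [Matrix.trace] using hρ.trace_eq_one

theorem cqBlock_eq {U Y R Q : Type*} [Fintype Y] {p : U × Y × Fin 2 → ℝ} {τ : Y → Matrix R R ℂ}
    {O : U → Fin 2 → Matrix R R ℂ} {z : ℝ} {D : Matrix R R ℂ}
    (h : ∀ u x, ∑ y, p (u, y, x) • τ y = z • O u x + D) (ρ : Fin 2 → Matrix Q Q ℂ) (u : U) :
    cqBlock p τ ρ u = z • ∑ x, O u x ⊗ₖ ρ x + D ⊗ₖ ∑ x, ρ x := by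
  simp only [cqBlock, h, Fin.sum_univ_two, Matrix.add_kronecker, Matrix.kronecker_add,
    Matrix.smul_kronecker, smul_add]
  abel

/-- If no channel existed, the separating observables, conjugated by the Weyl operators, would make
up a cq-state whose min-entropy is larger for `ρ` than for `σ`. -/
theorem exists_choiMap_of_completelyMoreInformative {Q Q' : Type*} [Fintype Q] [DecidableEq Q]
    [Fintype Q'] [DecidableEq Q'] [Nonempty Q] [Nonempty Q'] {ρ : Fin 2 → Matrix Q Q ℂ}
    {σ : Fin 2 → Matrix Q' Q' ℂ} (hρ : ∀ x, IsDensityMatrix (ρ x))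
    (hσ : ∀ x, IsDensityMatrix (σ x)) (h : CompletelyMoreInformative ρ σ) :
    ∃ J : Matrix (Q' × Q) (Q' × Q) ℂ,
      J.PosSemidef ∧ (∀ x, choiMap J (ρ x) = σ x) ∧ partialTrace J = 1 := by
  classical
  by_contra hno
  obtain ⟨T, S, hT, hpos, hlt⟩ := exists_separating_observables (fun x => (hρ x).1.1)
    (fun x => (hσ x).1.1) hno
  have : NeZero (Fintype.card Q') := ⟨Fintype.card_ne_zero⟩
  let e : Q' ≃ ZMod (Fintype.card Q') :=
    Fintype.equivOfCardEq (ZMod.card _).symm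
  let G := ZMod (Fintype.card Q')
  let U := G × AddChar G ℂ
  let W : U → Matrix G Q' ℂ := weylOperator e
  set d : ℝ := (Fintype.card Q' : ℝ) with hd
  have hd0 : 0 < d := by rw [hd]; exact_mod_cast Fintype.card_pos
  have hcardG : Fintype.card G = Fintype.card Q' := ZMod.card _
  have hcardU : Fintype.card U = Fintype.card Q' * Fintype.card Q' := by
    rw [Fintype.card_prod, AddChar.card_eq, hcardG]
  obtain ⟨Y, _, τ, hτ⟩ := exists_isCompleteCQChannel G
  let O : U → Fin 2 → Matrix G G ℂ := fun u x => W u * T x * (W u).conjTranspose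
  have hO : ∀ u x, (O u x).IsHermitian := fun u x =>
    Matrix.isHermitian_mul_mul_conjTranspose (W u) (hT x)
  obtain ⟨p, hp, z, hz, D, hD⟩ := hτ.exists_distribution hO
  -- The side of `ρ`: the certificate `S` gives an operator above all blocks.
  have hXle : ∀ u, cqBlock p τ ρ u ≤ z • ((1 : Matrix G G ℂ) ⊗ₖ S) + D ⊗ₖ ∑ x, ρ x := by
    intro u
    rw [cqBlock_eq hD ρ u, add_le_add_iff_right]
    have hconj := hpos.mul_mul_conjTranspose_same (W u ⊗ₖ (1 : Matrix Q Q ℂ))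
    rw [Matrix.mul_sub, Matrix.sub_mul, Matrix.mul_sum, Matrix.sum_mul,
      Matrix.conjTranspose_kronecker,
      Matrix.conjTranspose_one] at hconj
    simp only [← Matrix.mul_kronecker_mul, Matrix.one_mul, Matrix.mul_one] at hconj
    rw [weylOperator_mul_conjTranspose] at hconj
    rw [Matrix.le_iff, ← smul_sub]
    exact hconj.smul hz.le
  obtain ⟨hXpos, hlow⟩ := neg_logb_trace_le_condMinEntropy hp hτ.isDensityMatrix hρ hXle
  have hXtr : (z • ((1 : Matrix G G ℂ) ⊗ₖ S) + D ⊗ₖ ∑ x, ρ x).trace.re =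
      z * (d * S.trace.re) + 2 * D.trace.re := by
    rw [Matrix.trace_add, Matrix.trace_smul, Matrix.trace_kronecker, Matrix.trace_kronecker,
      Matrix.trace_one, Matrix.trace_sum, hcardG]
    simp [(hρ _).2, hd]
    ring
  -- The side of `σ`: the Weyl measurement guesses with a larger probability.
  have hσval : (∑ u, star (matrixVec (W u)) ⬝ᵥ (cqBlock p τ σ u).mulVec (matrixVec (W u))).re =
      d * (z * (d * ∑ x, (matrixPairing (T x) (σ x)).re) + 2 * D.trace.re) := by
    have hterm : ∀ u, star (matrixVec (W u)) ⬝ᵥ (cqBlock p τ σ u).mulVec (matrixVec (W u)) =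
        z * ∑ x, matrixPairing (T x) (σ x) +
          star (matrixVec (W u)) ⬝ᵥ (D ⊗ₖ ∑ x, σ x).mulVec (matrixVec (W u)) := by
      intro u
      have hWTW : ∀ x, (W u).conjTranspose * O u x * W u = T x := by
        intro x
        calc (W u).conjTranspose * (W u * T x * (W u).conjTranspose) * W u =
            ((W u).conjTranspose * W u) * T x * ((W u).conjTranspose * W u) := by
              simp only [Matrix.mul_assoc]
          _ = T x := by rw [conjTranspose_mul_weylOperator, Matrix.one_mul, Matrix.mul_one]
      rw [cqBlock_eq hD σ u, Matrix.add_mulVec, dotProduct_add, Matrix.smul_mulVec,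
        dotProduct_smul, Matrix.sum_mulVec, dotProduct_sum, Complex.real_smul]
      simp only [star_matrixVec_dotProduct_kronecker, hWTW]
    rw [Finset.sum_congr rfl fun u _ => hterm u, Finset.sum_add_distrib,
      sum_star_matrixVec_weylOperator, Finset.sum_const, Finset.card_univ, hcardU,
      Matrix.trace_kronecker, Matrix.trace_sum]
    simp [(hσ _).2, hd]
    ring
  have hvals : z * (d * S.trace.re) + 2 * D.trace.re <
      z * (d * ∑ x, (matrixPairing (T x) (σ x)).re) + 2 * D.trace.re := by
    gcongr
  rw [hXtr] at hXpos hlow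
  have hup : condMinEntropy (cqState p τ σ) ≤
      -Real.logb 2 (z * (d * ∑ x, (matrixPairing (T x) (σ x)).re) + 2 * D.trace.re) := by
    refine csSup_le (minEntropySet_nonempty (isDensityMatrix_cqState hp hτ.isDensityMatrix hσ)) ?_
    intro l hl
    have h1 := sum_weylOperator_le_of_mem_minEntropySet e hl
    rw [hσval, ← hd] at h1
    have h2 := le_of_mul_le_mul_left h1 hd0
    rw [le_neg, Real.logb_le_iff_le_rpow (by norm_num) (hXpos.trans hvals)]
    exact h2
  have hlog := Real.logb_lt_logb (by norm_num : (1 : ℝ) < 2) hXpos hvals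
  have hmain := h U G Y τ hτ p hp
  linarith

theorem proposition3 {Q Q' : Type*} [Fintype Q] [DecidableEq Q] [Fintype Q'] [DecidableEq Q']
    (ω ρ : Matrix Q Q ℂ) (ω' σ : Matrix Q' Q' ℂ)
    (hω : IsDensityMatrix ω) (hω' : IsDensityMatrix ω')
    (hρ : IsDensityMatrix ρ) (hσ : IsDensityMatrix σ) :
    ExistsGibbsPreservingTransition ω ω' ρ σ ↔ CompletelyLessThermal ω ω' ρ σ := by
  have hρω : ∀ x, IsDensityMatrix (![ρ, ω] x) := Fin.forall_fin_two.2 ⟨hρ, hω⟩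
  have hσω : ∀ x, IsDensityMatrix (![σ, ω'] x) := Fin.forall_fin_two.2 ⟨hσ, hω'⟩
  constructor
  · rintro ⟨Φ, htr, hΦω, hΦρ⟩ U R Y _ _ _ _ τ hτ p hp
    exact condMinEntropy_cqState_le Φ htr hp hτ.isDensityMatrix hρω hσω
      (Fin.forall_fin_two.2 ⟨hΦρ, hΦω⟩)
  · intro h
    have : Nonempty Q := hρ.nonempty
    have : Nonempty Q' := hσ.nonempty
    obtain ⟨J, hJ, hmap, hptr⟩ := exists_choiMap_of_completelyMoreInformative hρω hσω h
    exact ⟨choiCP J hJ, trace_choiMap hptr, hmap 1, hmap 0⟩
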